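/- For $A\subseteq\mathbb R^n$ let $d(A)$ be the set of Euclidean distances between distinct points of $A$; $A$ is an $s$-distance set if $|d(A)|\le s$. Let $V\subseteq\mathbb C^n$ be an affine variety (the set of common zeros of a set of polynomials, not necessarily irreducible), and let $\overline V\subseteq\mathbb P^n(\mathbb C)$ be its projective closure, i.e. the Zariski closure of the image of $V$ under $x\mapsto[1:x_1:\dots:x_n]$. Suppose that $\overline V$ has dimension $d\ge 0$ (as a topological space with the Zariski topology) and degree $k$ (i.e. $r!$ times the leading coefficient of the Hilbert polynomial of $\overline V$, where $r$ is the degree of this polynomial), and that the ideal $I(V)\subseteq\mathbb C[x_1,\dots,x_n]$ of all polynomials vanishing on $V$ is generated by polynomials with real coefficients. Then every $s$-distance set $A\subseteq V\cap\mathbb R^n$ satisfies $$|A|\le \frac{k\cdot s^d}{d!}+O(s^{d-1}).$$ That is, there is a constant $C$, depending only on $V$, such that for every integer $s\ge 1$ every $s$-distance set $A\subseteq V\cap\mathbb R^n$ is finite and satisfies $|A|\le \frac{k\, s^d}{d!}+C\,s^{d-1}$. -/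

import Mathlib

open scoped LinearAlgebra.Projectivization

namespace FewDistances

/-! Sets with few distances -/

/-- The set of non-zero distances determined by a subset of a metric space. -/
def distances {X : Type*} [MetricSpace X] (A : Set X) : Set ℝ :=
  {r : ℝ | ∃ p ∈ A, ∃ q ∈ A, p ≠ q ∧ r = dist p q}

/-- `A` is an `s`-distance set: it determines at most `s` different non-zero distances. -/
def IsDistanceSet {X : Type*} [MetricSpace X] (s : ℕ) (A : Set X) : Prop :=
  (distances A).encard ≤ (s : ℕ∞)

/-! Affine varieties -/

/-- An affine variety in `ℂⁿ` (not necessarily irreducible): the set of common zeros of a set of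
polynomials. -/
def IsAffineVariety {n : ℕ} (V : Set (Fin n → ℂ)) : Prop :=
  ∃ S : Set (MvPolynomial (Fin n) ℂ), V = {x | ∀ f ∈ S, MvPolynomial.eval x f = 0}

/-- The ideal `J` of `ℂ[x₁, …, xₙ]` is generated by polynomials with real coefficients. -/
def IsGeneratedByReal {n : ℕ} (J : Ideal (MvPolynomial (Fin n) ℂ)) : Prop :=
  ∃ G : Set (MvPolynomial (Fin n) ℝ), J = Ideal.span (MvPolynomial.map Complex.ofRealHom '' G)

/-- The inclusion `ℝⁿ → ℂⁿ`. -/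
def toComplex {n : ℕ} (x : EuclideanSpace ℝ (Fin n)) : Fin n → ℂ := fun i => (x i : ℂ)

/-! Projective space with its Zariski topology -/

/-- The complex projective space of dimension `n`. -/
abbrev ProjSpace (n : ℕ) : Type := ℙ ℂ (Fin (n + 1) → ℂ)

/-- A polynomial that is homogeneous of some degree. -/
def IsForm {n : ℕ} (f : MvPolynomial (Fin (n + 1)) ℂ) : Prop :=
  ∃ m : ℕ, f.IsHomogeneous m

/-- The common zeros in projective space of a set of forms. For a form, vanishing at a
representative of a point does not depend on the representative. -/
def projZeros {n : ℕ} (S : Set (MvPolynomial (Fin (n + 1)) ℂ)) : Set (ProjSpace n) :=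
  {p | ∀ f ∈ S, MvPolynomial.eval p.rep f = 0}

/-- The closed sets of the Zariski topology: zero sets of sets of forms. -/
def IsZariskiClosed {n : ℕ} (X : Set (ProjSpace n)) : Prop :=
  ∃ S : Set (MvPolynomial (Fin (n + 1)) ℂ), (∀ f ∈ S, IsForm f) ∧ X = projZeros S

theorem isZariskiClosed_empty (n : ℕ) : IsZariskiClosed (∅ : Set (ProjSpace n)) := by
  refine ⟨{1}, ?_, ?_⟩
  · rintro f rfl
    exact ⟨0, MvPolynomial.isHomogeneous_one _ _⟩
  · ext p
    simp [projZeros]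

theorem isZariskiClosed_sInter {n : ℕ} (C : Set (Set (ProjSpace n)))
    (hC : ∀ X ∈ C, IsZariskiClosed X) : IsZariskiClosed (⋂₀ C) := by
  refine ⟨{f | IsForm f ∧ ∃ X ∈ C, ∀ p ∈ X, MvPolynomial.eval p.rep f = 0},
    fun f hf => hf.1, ?_⟩
  ext p
  constructor
  · rintro hp f ⟨-, X, hX, hf⟩
    exact hf p (hp X hX)
  · intro hp X hX
    obtain ⟨S, hS, rfl⟩ := hC X hX
    exact fun f hf => hp f ⟨hS f hf, _, hX, fun q hq => hq f hf⟩

theorem isZariskiClosed_union {n : ℕ} (X : Set (ProjSpace n)) (hX : IsZariskiClosed X)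
    (Y : Set (ProjSpace n)) (hY : IsZariskiClosed Y) : IsZariskiClosed (X ∪ Y) := by
  obtain ⟨S, hS, rfl⟩ := hX
  obtain ⟨T, hT, rfl⟩ := hY
  refine ⟨{h | ∃ f ∈ S, ∃ g ∈ T, h = f * g}, ?_, ?_⟩
  · rintro h ⟨f, hf, g, hg, rfl⟩
    obtain ⟨a, ha⟩ := hS f hf
    obtain ⟨b, hb⟩ := hT g hg
    exact ⟨a + b, ha.mul hb⟩
  · ext p
    constructor
    · rintro (hp | hp) h ⟨f, hf, g, hg, rfl⟩
      · simp [hp f hf]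
      · simp [hp g hg]
    · intro hp
      by_contra hcon
      simp only [Set.mem_union, projZeros, Set.mem_ofPred_eq, not_or, not_forall] at hcon
      obtain ⟨⟨f, hf, hf0⟩, ⟨g, hg, hg0⟩⟩ := hcon
      have h := hp (f * g) ⟨f, hf, g, hg, rfl⟩
      rw [map_mul] at h
      exact (mul_ne_zero hf0 hg0) h

/-- The Zariski topology on projective space. -/
@[reducible] def zariskiTopology (n : ℕ) : TopologicalSpace (ProjSpace n) :=
  TopologicalSpace.ofClosed {X | IsZariskiClosed X} (isZariskiClosed_empty n)
    (fun C hC => isZariskiClosed_sInter C (fun _ hX => hC hX))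
    (fun X hX Y hY => isZariskiClosed_union X hX Y hY)

/-- The standard open embedding `x ↦ [1 : x₁ : … : xₙ]` of affine into projective space. -/
noncomputable def toProj {n : ℕ} (x : Fin n → ℂ) : ProjSpace n :=
  Projectivization.mk ℂ (Fin.cons 1 x : Fin (n + 1) → ℂ)
    (fun h => one_ne_zero (congrFun h 0))

/-- The projective closure of a subset of affine space: the Zariski closure of its image in
projective space. -/
noncomputable def projClosure {n : ℕ} (V : Set (Fin n → ℂ)) : Set (ProjSpace n) :=
  @closure (ProjSpace n) (zariskiTopology n) (toProj '' V)

/-! Dimension and degree of a subset of projective space -/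

/-- The dimension of a subset of projective space: the Krull dimension of the subset as a
topological space with the topology induced by the Zariski topology
(the supremum of the lengths of chains of irreducible closed subsets). -/
noncomputable def projDim {n : ℕ} (X : Set (ProjSpace n)) : WithBot ℕ∞ :=
  @topologicalKrullDim X (TopologicalSpace.induced Subtype.val (zariskiTopology n))

/-- The homogeneous ideal of a subset of projective space: the ideal generated by the forms that
vanish on it. -/
noncomputable def homogIdeal {n : ℕ} (X : Set (ProjSpace n)) : Ideal (MvPolynomial (Fin (n + 1)) ℂ) :=
  Ideal.span {f | IsForm f ∧ ∀ p ∈ X, MvPolynomial.eval p.rep f = 0}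

/-- The (projective) Hilbert function of `X`: its value at `m` is the dimension of the degree `m`
part of the homogeneous coordinate ring of `X`. -/
noncomputable def hilbertFunction {n : ℕ} (X : Set (ProjSpace n)) (m : ℕ) : ℕ :=
  Module.finrank ℂ
    (MvPolynomial.homogeneousSubmodule (Fin (n + 1)) ℂ m ⧸
      ((homogIdeal X).restrictScalars ℂ).comap
        (MvPolynomial.homogeneousSubmodule (Fin (n + 1)) ℂ m).subtype)

open Classical in
/-- The Hilbert polynomial of `X`: the polynomial over `ℚ` that agrees with the Hilbert function at
all large arguments (at most one such polynomial exists). -/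
noncomputable def hilbertPolynomial {n : ℕ} (X : Set (ProjSpace n)) : Polynomial ℚ :=
  if h : ∃ P : Polynomial ℚ, ∀ᶠ m : ℕ in Filter.atTop,
      P.eval (m : ℚ) = (hilbertFunction X m : ℚ)
  then h.choose else 0

/-- The degree of `X`: if the Hilbert polynomial of `X` has degree `r`, it is `r !` times the
leading coefficient of the Hilbert polynomial. -/
noncomputable def projDegree {n : ℕ} (X : Set (ProjSpace n)) : ℚ :=
  (Nat.factorial (hilbertPolynomial X).natDegree : ℚ) * (hilbertPolynomial X).leadingCoeff

end FewDistances

/-! The polynomial method gives `|A| ≤ H(s)`, where `H` is the Hilbert function of the projective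
closure. Forms of degree `s` modulo the homogeneous ideal are evaluated at the points of `A`, and
this map is onto `ℂ^A`. Otherwise a nonzero weight `v` on `A` kills all monomials of degree at most
`s`. Take `f(x, y) = ∏ (r² - |x - y|²)` over the distances `r`. It has degree at most `2s`, so each
of its monomials has degree at most `s` in `x` or in `y`, and `∑ conj(v a) v b f(a, b) = 0`. But on
`A × A` the matrix of `f` is a nonzero scalar matrix, so `∑ |v a|² = 0`
(`eq_zero_of_moments_eq_zero`, `card_le_hilbertFunction`).

It remains to see that `H` is eventually a polynomial of degree at most `d`
(`exists_polynomial_eventually_eq_idealHilbertFunction`). Noetherian induction on homogeneous ideals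
produces this polynomial together with a chain of irreducible closed sets at least as long as its
degree. The finitely many small `s` are absorbed into the constant. -/

namespace FewDistances

/-! ### Hilbert functions of homogeneous ideals -/

section HilbertFunction

open MvPolynomial

attribute [local instance] MvPolynomial.gradedAlgebra

variable {σ K : Type*} [Field K]

/-- The dimension of the degree `m` part of the quotient by an ideal. -/
noncomputable def idealHilbertFunction (I : Ideal (MvPolynomial σ K)) (m : ℕ) : ℕ :=
  Module.finrank K (homogeneousSubmodule σ K m ⧸
    (I.restrictScalars K).comap (homogeneousSubmodule σ K m).subtype)

/-- The degree `m` part of an ideal. -/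
noncomputable def idealPart (I : Ideal (MvPolynomial σ K)) (m : ℕ) : Submodule K (MvPolynomial σ K) :=
  I.restrictScalars K ⊓ homogeneousSubmodule σ K m

instance finiteDimensional_homogeneousSubmodule [Finite σ] (m : ℕ) :
    FiniteDimensional K (homogeneousSubmodule σ K m) :=
  Module.Finite.iff_fg.mpr (homogeneousSubmodule_fg σ K m)

instance finiteDimensional_idealPart [Finite σ] (I : Ideal (MvPolynomial σ K)) (m : ℕ) :
    FiniteDimensional K (idealPart I m) :=
  Submodule.finiteDimensional_of_le (inf_le_right : _ ≤ homogeneousSubmodule σ K m)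

theorem idealHilbertFunction_add_finrank_idealPart [Finite σ] (I : Ideal (MvPolynomial σ K))
    (m : ℕ) :
    idealHilbertFunction I m + Module.finrank K (idealPart I m) =
      Module.finrank K (homogeneousSubmodule σ K m) := by
  have h := Submodule.finrank_quotient_add_finrank
    ((I.restrictScalars K).comap (homogeneousSubmodule σ K m).subtype)
  have e : Module.finrank K (idealPart I m) = Module.finrank K
      ((I.restrictScalars K).comap (homogeneousSubmodule σ K m).subtype) := by
    rw [← Submodule.finrank_map_subtype_eq (homogeneousSubmodule σ K m)
      ((I.restrictScalars K).comap (homogeneousSubmodule σ K m).subtype),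
      Submodule.map_comap_subtype, idealPart, inf_comm]
  rw [idealHilbertFunction, e, h]

theorem homogeneousComponent_mul_of_isHomogeneous {f : MvPolynomial σ K} {e : ℕ}
    (hf : f.IsHomogeneous e) (g : MvPolynomial σ K) (m : ℕ) :
    homogeneousComponent (m + e) (g * f) = homogeneousComponent m g * f := by
  have h := DirectSum.coe_decompose_mul_add_of_right_mem (homogeneousSubmodule σ K) (i := m)
    (a := g) (b := f) hf
  have h1 := decomposition.decompose'_apply (g * f) (m + e)
  have h2 := decomposition.decompose'_apply g m
  rw [← h1, ← h2]
  exact h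

theorem isHomogeneous_colon {I : Ideal (MvPolynomial σ K)}
    (hI : I.IsHomogeneous (homogeneousSubmodule σ K)) {f : MvPolynomial σ K} {e : ℕ}
    (hf : f.IsHomogeneous e) :
    (Submodule.colon I {f}).IsHomogeneous (homogeneousSubmodule σ K) := by
  intro m g hg
  rw [Submodule.mem_colon_singleton] at hg ⊢
  have h := homogeneousComponent_mem_of_mem hI hg (m + e)
  rw [smul_eq_mul, homogeneousComponent_mul_of_isHomogeneous hf] at h
  have h2 := decomposition.decompose'_apply g m
  rw [← h2] at h
  exact h

theorem isHomogeneous_sup_span {I : Ideal (MvPolynomial σ K)}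
    (hI : I.IsHomogeneous (homogeneousSubmodule σ K)) {f : MvPolynomial σ K} {e : ℕ}
    (hf : f.IsHomogeneous e) :
    (I ⊔ Ideal.span {f}).IsHomogeneous (homogeneousSubmodule σ K) := by
  refine Ideal.IsHomogeneous.sup hI (Ideal.homogeneous_span _ _ ?_)
  rintro g rfl
  exact ⟨e, hf⟩

theorem idealPart_sup_span {I : Ideal (MvPolynomial σ K)}
    (hI : I.IsHomogeneous (homogeneousSubmodule σ K)) {f : MvPolynomial σ K} {e : ℕ}
    (hf : f.IsHomogeneous e) (m : ℕ) :
    idealPart (I ⊔ Ideal.span {f}) (m + e) =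
      idealPart I (m + e) ⊔ (homogeneousSubmodule σ K m).map (LinearMap.mulRight K f) := by
  apply le_antisymm
  · rintro p ⟨hp, hpm⟩
    obtain ⟨a, ha, b, hb, rfl⟩ := Submodule.mem_sup.mp hp
    obtain ⟨g, rfl⟩ := Ideal.mem_span_singleton'.mp hb
    rw [← homogeneousComponent_eq_self hpm, map_add,
      homogeneousComponent_mul_of_isHomogeneous hf]
    exact Submodule.add_mem_sup
      ⟨homogeneousComponent_mem_of_mem hI ha _, homogeneousComponent_isHomogeneous _ _⟩
      ⟨_, homogeneousComponent_isHomogeneous m g, rfl⟩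
  · refine sup_le (fun p hp => ⟨Ideal.mem_sup_left hp.1, hp.2⟩) ?_
    rintro _ ⟨g, hg, rfl⟩
    exact ⟨Ideal.mem_sup_right (Ideal.mul_mem_left _ _ (Ideal.mem_span_singleton_self f)),
      IsHomogeneous.mul hg hf⟩

theorem idealPart_inf_map_mulRight (I : Ideal (MvPolynomial σ K)) {f : MvPolynomial σ K} {e : ℕ}
    (hf : f.IsHomogeneous e) (m : ℕ) :
    idealPart I (m + e) ⊓ (homogeneousSubmodule σ K m).map (LinearMap.mulRight K f) =
      (idealPart (Submodule.colon I {f}) m).map (LinearMap.mulRight K f) := by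
  apply le_antisymm
  · rintro _ ⟨hp, g, hg, rfl⟩
    exact ⟨g, ⟨Submodule.mem_colon_singleton.mpr hp.1, hg⟩, rfl⟩
  · rintro _ ⟨g, ⟨hgI, hg⟩, rfl⟩
    exact ⟨⟨Submodule.mem_colon_singleton.mp hgI, IsHomogeneous.mul hg hf⟩, g, hg, rfl⟩

/-- Additivity of the Hilbert function along multiplication by a form. -/
theorem idealHilbertFunction_eq_colon_add_sup [Finite σ] {I : Ideal (MvPolynomial σ K)}
    (hI : I.IsHomogeneous (homogeneousSubmodule σ K)) {f : MvPolynomial σ K} {e : ℕ}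
    (hf : f.IsHomogeneous e) (hf0 : f ≠ 0) (m : ℕ) :
    idealHilbertFunction I (m + e) =
      idealHilbertFunction (Submodule.colon I {f}) m +
        idealHilbertFunction (I ⊔ Ideal.span {f}) (m + e) := by
  have hinj : Function.Injective (LinearMap.mulRight K f) :=
    fun a b hab => mul_right_cancel₀ hf0 hab
  -- In degree `m + e`, the sum of `I` and the multiples of `f` is the part of `I + (f)`, and their
  -- intersection is `f` times the degree `m` part of `I : f`.
  have h := Submodule.finrank_sup_add_finrank_inf_eq (idealPart I (m + e))
    ((homogeneousSubmodule σ K m).map (LinearMap.mulRight K f))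
  rw [← idealPart_sup_span hI hf, idealPart_inf_map_mulRight I hf,
    ← (Submodule.equivMapOfInjective _ hinj _).finrank_eq,
    ← (Submodule.equivMapOfInjective _ hinj _).finrank_eq] at h
  have h1 := idealHilbertFunction_add_finrank_idealPart I (m + e)
  have h2 := idealHilbertFunction_add_finrank_idealPart (Submodule.colon I {f}) m
  have h3 := idealHilbertFunction_add_finrank_idealPart (I ⊔ Ideal.span {f}) (m + e)
  omega

theorem idealHilbertFunction_top (m : ℕ) :
    idealHilbertFunction (⊤ : Ideal (MvPolynomial σ K)) m = 0 := by
  have : Subsingleton (homogeneousSubmodule σ K m ⧸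
      ((⊤ : Ideal (MvPolynomial σ K)).restrictScalars K).comap
        (homogeneousSubmodule σ K m).subtype) := by
    rw [Submodule.Quotient.subsingleton_iff]
    exact top_unique fun _ _ => trivial
  exact Module.finrank_zero_of_subsingleton

theorem mem_of_forall_X_mem {I : Ideal (MvPolynomial σ K)} (h : ∀ i, X i ∈ I)
    {f : MvPolynomial σ K} {m : ℕ} (hf : f.IsHomogeneous m) (hm : m ≠ 0) : f ∈ I := by
  rw [f.as_sum]
  refine Ideal.sum_mem _ fun d hd => ?_
  have hd' : d ≠ 0 := by
    rintro rfl
    exact hm (by simpa using (hf (mem_support_iff.mp hd)).symm)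
  obtain ⟨i, hi⟩ := Finsupp.ne_iff.mp hd'
  have hle : Finsupp.single i 1 ≤ d := by
    rw [Finsupp.single_le_iff]
    exact Nat.one_le_iff_ne_zero.mpr hi
  have : monomial d (coeff d f) = monomial (d - Finsupp.single i 1) (coeff d f) * X i := by
    rw [X, monomial_mul, mul_one, tsub_add_cancel_of_le hle]
  rw [this]
  exact Ideal.mul_mem_left _ _ (h i)

theorem idealHilbertFunction_of_forall_X_mem {I : Ideal (MvPolynomial σ K)} (h : ∀ i, X i ∈ I)
    {m : ℕ} (hm : m ≠ 0) : idealHilbertFunction I m = 0 := by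
  have : Subsingleton (homogeneousSubmodule σ K m ⧸ (I.restrictScalars K).comap
        (homogeneousSubmodule σ K m).subtype) := by
    rw [Submodule.Quotient.subsingleton_iff]
    exact top_unique fun f _ => mem_of_forall_X_mem h f.2 hm
  exact Module.finrank_zero_of_subsingleton

end HilbertFunction

/-! ### Summation of polynomial sequences -/

section Summation

open Polynomial

theorem natDegree_bernoulli_le (n : ℕ) : (Polynomial.bernoulli n).natDegree ≤ n :=
  natDegree_sum_le_of_forall_le _ _ fun _ _ =>
    (natDegree_monomial_le _).trans (Nat.sub_le _ _)

/-- Every rational polynomial is the difference of a polynomial of degree one more. -/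
theorem exists_eval_add_one_sub_eval (Q : ℚ[X]) :
    ∃ P : ℚ[X], P.natDegree ≤ Q.natDegree + 1 ∧
      ∀ x : ℚ, P.eval (x + 1) - P.eval x = Q.eval x := by
  -- Bernoulli polynomials satisfy `B_{j+1}(x+1) - B_{j+1}(x) = (j+1) x^j`.
  refine ⟨∑ j ∈ Finset.range (Q.natDegree + 1),
    C (Q.coeff j / (j + 1)) * Polynomial.bernoulli (j + 1), ?_, fun x => ?_⟩
  · refine natDegree_sum_le_of_forall_le _ _ fun j hj => ?_
    refine (natDegree_C_mul_le _ _).trans ((natDegree_bernoulli_le _).trans ?_)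
    have := Finset.mem_range.mp hj
    omega
  · rw [eval_finsetSum, eval_finsetSum, ← Finset.sum_sub_distrib, eval_eq_sum_range]
    refine Finset.sum_congr rfl fun j _ => ?_
    have h := congrArg (Polynomial.eval x) (bernoulli_comp_one_add_X (j + 1))
    simp only [eval_comp, eval_add, eval_one, eval_X, eval_smul, eval_pow,
      Nat.add_sub_cancel] at h
    have hj : (j : ℚ) + 1 ≠ 0 := by positivity
    rw [eval_mul, eval_mul, eval_C, eval_C, ← mul_sub, add_comm x 1, h]
    simp only [add_sub_cancel_left, nsmul_eq_mul]
    push_cast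
    field_simp

/-- A sequence whose differences are eventually polynomial is eventually polynomial. -/
theorem exists_polynomial_of_difference {H : ℕ → ℚ} {Q : ℚ[X]}
    (hQ : ∀ᶠ m : ℕ in Filter.atTop, H (m + 1) - H m = Q.eval ((m : ℚ) + 1)) :
    ∃ P : ℚ[X], (∀ᶠ m : ℕ in Filter.atTop, P.eval (m : ℚ) = H m) ∧
      P.natDegree ≤ Q.natDegree + 1 ∧ (Q = 0 → P.natDegree = 0) := by
  obtain ⟨R, hR, hRQ⟩ : ∃ R : ℚ[X], (R.natDegree ≤ Q.natDegree + 1 ∧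
      (Q = 0 → R.natDegree = 0)) ∧ ∀ x : ℚ, R.eval (x + 1) - R.eval x = Q.eval (x + 1) := by
    -- As `natDegree 0 = 0`, the general bound would only give degree 1 here, although an eventually
    -- constant sequence has a constant polynomial.
    obtain rfl | h0 := eq_or_ne Q 0
    · exact ⟨0, by simp⟩
    · obtain ⟨R, hR, hRQ⟩ := exists_eval_add_one_sub_eval (Q.comp (X + C 1))
      rw [natDegree_comp, natDegree_X_add_C, mul_one] at hR
      exact ⟨R, ⟨hR, fun h => absurd h h0⟩, fun x => by simpa using hRQ x⟩
  obtain ⟨N, hN⟩ := Filter.eventually_atTop.mp hQ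
  refine ⟨R + C (H N - R.eval (N : ℚ)), ?_, ?_⟩
  · filter_upwards [Filter.eventually_ge_atTop N] with m hm
    induction m, hm using Nat.le_induction with
    | base => simp
    | succ m hm ih =>
      have h1 := hN m hm
      have h2 := hRQ m
      simp only [eval_add, eval_C] at ih ⊢
      push_cast
      linarith
  · rwa [natDegree_add_C]

end Summation

/-! ### Zariski topology, Hilbert polynomial and dimension -/

section ZariskiTopology

open MvPolynomial TopologicalSpace

attribute [local instance] MvPolynomial.gradedAlgebra zariskiTopology

variable {n : ℕ}

theorem eval_smul_of_isHomogeneous {σ K : Type*} [CommSemiring K] {f : MvPolynomial σ K} {m : ℕ}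
    (hf : f.IsHomogeneous m) (c : K) (v : σ → K) : eval (c • v) f = c ^ m * eval v f := by
  rw [eval_eq, eval_eq, Finset.mul_sum]
  refine Finset.sum_congr rfl fun d hd => ?_
  have hdm : d.degree = m := by
    by_contra h
    exact mem_support_iff.mp hd (hf.coeff_eq_zero h)
  simp only [Pi.smul_apply, smul_eq_mul, mul_pow, Finset.prod_mul_distrib,
    Finset.prod_pow_eq_pow_sum]
  rw [← hdm, Finsupp.degree_apply]
  ring

theorem eval_mk_rep_eq_zero_iff {f : MvPolynomial (Fin (n + 1)) ℂ} (hf : IsForm f)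
    {v : Fin (n + 1) → ℂ} (hv : v ≠ 0) :
    eval (Projectivization.mk ℂ v hv).rep f = 0 ↔ eval v f = 0 := by
  obtain ⟨m, hm⟩ := hf
  obtain ⟨a, ha⟩ := Projectivization.exists_smul_eq_mk_rep ℂ v hv
  have : eval (Projectivization.mk ℂ v hv).rep f = (a : ℂ) ^ m * eval v f := by
    rw [← ha]
    exact eval_smul_of_isHomogeneous hm (a : ℂ) v
  rw [this]
  simp

theorem isClosed_iff_isZariskiClosed {X : Set (ProjSpace n)} :
    IsClosed X ↔ IsZariskiClosed X := by
  rw [← isOpen_compl_iff]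
  change IsZariskiClosed Xᶜᶜ ↔ _
  rw [compl_compl]

theorem isClosed_projZeros {S : Set (MvPolynomial (Fin (n + 1)) ℂ)} (hS : ∀ f ∈ S, IsForm f) :
    IsClosed (projZeros S) :=
  isClosed_iff_isZariskiClosed.mpr ⟨S, hS, rfl⟩

/-- The zeros in projective space of the forms in an ideal. -/
def idealZeros (I : Ideal (MvPolynomial (Fin (n + 1)) ℂ)) : Set (ProjSpace n) :=
  projZeros {f | IsForm f ∧ f ∈ I}

theorem isClosed_idealZeros (I : Ideal (MvPolynomial (Fin (n + 1)) ℂ)) :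
    IsClosed (idealZeros I) :=
  isClosed_projZeros fun _ hf => hf.1

theorem idealZeros_anti {I J : Ideal (MvPolynomial (Fin (n + 1)) ℂ)} (h : I ≤ J) :
    idealZeros J ⊆ idealZeros I :=
  fun _ hp f hf => hp f ⟨hf.1, h hf.2⟩

/-- The projective Nullstellensatz for a homogeneous prime ideal. -/
theorem mem_of_forall_idealZeros {I : Ideal (MvPolynomial (Fin (n + 1)) ℂ)} (hI : I.IsPrime)
    {i : Fin (n + 1)} (hi : X i ∉ I) {f : MvPolynomial (Fin (n + 1)) ℂ} (hf : IsForm f)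
    (h : ∀ p ∈ idealZeros I, eval p.rep f = 0) : f ∈ I := by
  -- The affine Nullstellensatz also sees the origin, which has no projective point. The factor `X
  -- i` vanishes there and is cancelled by primality.
  have hmem : f * X i ∈ vanishingIdeal ℂ (zeroLocus ℂ I) := by
    intro x hx
    obtain rfl | hx0 := eq_or_ne x 0
    · simp
    · have hp : Projectivization.mk ℂ x hx0 ∈ idealZeros I := fun g hg =>
        (eval_mk_rep_eq_zero_iff hg.1 hx0).mpr (by simpa using hx g hg.2)
      have := (eval_mk_rep_eq_zero_iff hf hx0).mp (h _ hp)
      simp [this]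
  rw [IsPrime.vanishingIdeal_zeroLocus] at hmem
  exact (hI.mem_or_mem hmem).resolve_right hi

theorem isIrreducible_idealZeros {I : Ideal (MvPolynomial (Fin (n + 1)) ℂ)} (hI : I.IsPrime)
    {i : Fin (n + 1)} (hi : X i ∉ I) : IsIrreducible (idealZeros I) := by
  constructor
  · by_contra hne
    rw [Set.not_nonempty_iff_eq_empty] at hne
    refine hI.one_notMem (mem_of_forall_idealZeros hI hi ⟨0, isHomogeneous_one _ _⟩ ?_)
    simp [hne]
  · rw [isPreirreducible_iff_isClosed_union_isClosed]
    intro Y Z hY hZ hYZ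
    obtain ⟨S, hS, rfl⟩ := isClosed_iff_isZariskiClosed.mp hY
    obtain ⟨T, hT, rfl⟩ := isClosed_iff_isZariskiClosed.mp hZ
    by_contra! hcon
    obtain ⟨⟨p, hpI, hp⟩, ⟨q, hqI, hq⟩⟩ := hcon.imp Set.not_subset.mp Set.not_subset.mp
    simp only [projZeros, Set.mem_ofPred_eq, not_forall] at hp hq
    obtain ⟨f, hf, hfp⟩ := hp
    obtain ⟨g, hg, hgq⟩ := hq
    obtain ⟨a, ha⟩ := hS f hf
    obtain ⟨b, hb⟩ := hT g hg
    have hfg : f * g ∈ I := by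
      refine mem_of_forall_idealZeros hI hi ⟨a + b, ha.mul hb⟩ fun r hr => ?_
      rcases hYZ hr with h | h
      · simp [h f hf]
      · simp [h g hg]
    rcases hI.mem_or_mem hfg with h | h
    · exact hfp (hpI f ⟨⟨a, ha⟩, h⟩)
    · exact hgq (hqI g ⟨⟨b, hb⟩, h⟩)

/-- Since every member of the chain lies in `X`, passing to the subspace keeps the members
irreducible and closed and the inclusions strict. -/
theorem length_le_projDim {X : Set (ProjSpace n)} (l : LTSeries (IrreducibleCloseds (ProjSpace n)))
    (hl : (l.last : Set (ProjSpace n)) ⊆ X) : ((l.length : ℕ∞) : WithBot ℕ∞) ≤ projDim X := by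
  have hsub (i) : (l i : Set (ProjSpace n)) ⊆ X :=
    fun p hp => hl (SetLike.coe_subset_coe.mpr (l.monotone (Fin.le_last i)) hp)
  have himage (i) : ((↑) : X → ProjSpace n) '' ((↑) ⁻¹' (l i : Set (ProjSpace n))) = l i := by
    rw [Subtype.image_preimage_coe, Set.inter_eq_right.mpr (hsub i)]
  have hirr (i) : IsIrreducible (((↑) : X → ProjSpace n) ⁻¹' (l i : Set (ProjSpace n))) := by
    constructor
    · obtain ⟨p, hp⟩ := (l i).isIrreducible.nonempty
      exact ⟨⟨p, hsub i hp⟩, hp⟩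
    · rintro _ _ ⟨U, hU, rfl⟩ ⟨W, hW, rfl⟩ ⟨p, hp, hpU⟩ ⟨q, hq, hqW⟩
      obtain ⟨r, hr, hrU, hrW⟩ := (l i).isIrreducible.isPreirreducible U W hU hW
        ⟨p, hp, hpU⟩ ⟨q, hq, hqW⟩
      exact ⟨⟨r, hsub i hr⟩, hr, hrU, hrW⟩
  let l' : LTSeries (IrreducibleCloseds X) := LTSeries.mk l.length
    (fun i => ⟨_, hirr i, (l i).isClosed.preimage continuous_subtype_val⟩) (by
      intro i j hij
      have h := l.strictMono hij
      rw [← SetLike.coe_ssubset_coe] at h ⊢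
      refine ⟨fun p hp => h.1 hp, fun hji => h.2 ?_⟩
      rw [← himage i, ← himage j]
      exact Set.image_mono hji)
  exact Order.LTSeries.length_le_krullDim l'

/-- The Hilbert function of a homogeneous ideal is eventually polynomial, of degree at most the
length of some chain of irreducible closed subsets of the zero set. -/
theorem exists_polynomial_eventually_eq_idealHilbertFunction
    (I : Ideal (MvPolynomial (Fin (n + 1)) ℂ))
    (hI : I.IsHomogeneous (homogeneousSubmodule (Fin (n + 1)) ℂ)) :
    ∃ P : Polynomial ℚ,
      (∀ᶠ m : ℕ in Filter.atTop, P.eval (m : ℚ) = (idealHilbertFunction I m : ℚ)) ∧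
      (P = 0 ∨ ∃ l : LTSeries (IrreducibleCloseds (ProjSpace n)),
        (l.last : Set (ProjSpace n)) ⊆ idealZeros I ∧ P.natDegree ≤ l.length) := by
  induction I using WellFoundedGT.induction with
  | ind I ih =>
  obtain rfl | hItop := eq_or_ne I ⊤
  · exact ⟨0, by simp [idealHilbertFunction_top], .inl rfl⟩
  by_cases hprime : I.IsPrime
  · by_cases hX : ∀ i, X i ∈ I
    · refine ⟨0, ?_, .inl rfl⟩
      filter_upwards [Filter.eventually_ne_atTop 0] with m hm
      simp [idealHilbertFunction_of_forall_X_mem hX hm]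
    push Not at hX
    obtain ⟨i, hi⟩ := hX
    have hXi : (X i : MvPolynomial (Fin (n + 1)) ℂ).IsHomogeneous 1 := isHomogeneous_X _ _
    -- With `I : X i = I`, additivity turns the first difference of the Hilbert function of `I` into
    -- the Hilbert function of the larger ideal `I + (X i)`.
    have hcolon : Submodule.colon I {X i} = I := by
      ext g
      rw [Submodule.mem_colon_singleton, smul_eq_mul]
      exact ⟨fun h => (hprime.mem_or_mem h).resolve_right hi, fun h => I.mul_mem_right _ h⟩
    have hlt : I < I ⊔ Ideal.span {X i} :=
      lt_of_le_of_ne le_sup_left fun h => hi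
        (h ▸ Ideal.mem_sup_right (Ideal.mem_span_singleton_self _))
    obtain ⟨Q, hQ, hQl⟩ := ih _ hlt (isHomogeneous_sup_span hI hXi)
    have hdiff : ∀ᶠ m : ℕ in Filter.atTop, (idealHilbertFunction I (m + 1) : ℚ)
        - idealHilbertFunction I m = Q.eval ((m : ℚ) + 1) := by
      filter_upwards [(Filter.tendsto_add_atTop_nat 1).eventually hQ] with m hm
      have h := idealHilbertFunction_eq_colon_add_sup hI hXi (X_ne_zero i) m
      rw [hcolon] at h
      rw [h]
      push_cast at hm ⊢
      rw [hm]
      ring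
    obtain ⟨P, hP, hdeg, hdeg0⟩ :=
      exists_polynomial_of_difference (H := fun m => (idealHilbertFunction I m : ℚ)) hdiff
    refine ⟨P, hP, .inr ?_⟩
    let Z : IrreducibleCloseds (ProjSpace n) :=
      ⟨idealZeros I, isIrreducible_idealZeros hprime hi, isClosed_idealZeros I⟩
    obtain hQ0 | ⟨l, hl, hlen⟩ := hQl
    · exact ⟨RelSeries.singleton _ Z, subset_rfl, by simp [hdeg0 hQ0]⟩
    -- The hyperplane section is proper: `X i` vanishes on it but not on all of `Z`. The degree
    -- rises by at most one, and so does the chain.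
    · have hlast : l.last < Z := by
        rw [← SetLike.coe_ssubset_coe]
        refine ⟨hl.trans (idealZeros_anti le_sup_left), fun hsub => hi ?_⟩
        refine mem_of_forall_idealZeros hprime hi ⟨1, hXi⟩ fun p hp => ?_
        exact hl (hsub hp) _ ⟨⟨1, hXi⟩, Ideal.mem_sup_right (Ideal.mem_span_singleton_self _)⟩
      refine ⟨l.snoc Z hlast, ?_, ?_⟩
      · rw [RelSeries.last_snoc]
        exact subset_rfl
      · rw [RelSeries.snoc_length]
        omega
  -- For homogeneous ideals primality can be tested on forms. A failing pair makes both `I : f`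
  -- (which contains `g`) and `I + (f)` strictly larger than `I`.
  · obtain ⟨f, g, ⟨e, hf⟩, hg, hfg, hfI, hgI⟩ : ∃ f g : MvPolynomial (Fin (n + 1)) ℂ,
        SetLike.IsHomogeneousElem (homogeneousSubmodule (Fin (n + 1)) ℂ) f ∧
        SetLike.IsHomogeneousElem (homogeneousSubmodule (Fin (n + 1)) ℂ) g ∧
        f * g ∈ I ∧ f ∉ I ∧ g ∉ I := by
      by_contra! hcon
      refine hprime (hI.isPrime_of_homogeneous_mem_or_mem hItop fun {x y} hx hy hxy => ?_)
      by_contra! h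
      exact h.2 (hcon x y hx hy hxy h.1)
    have hf0 : f ≠ 0 := fun h => hfI (h ▸ I.zero_mem)
    have hle1 : I ≤ Submodule.colon I {f} := fun x hx =>
      Submodule.mem_colon_singleton.mpr (I.mul_mem_right f hx)
    have hlt1 : I < Submodule.colon I {f} := lt_of_le_of_ne hle1 fun h => hgI <| by
      rw [h, Submodule.mem_colon_singleton, smul_eq_mul, mul_comm]
      exact hfg
    have hlt2 : I < I ⊔ Ideal.span {f} :=
      lt_of_le_of_ne le_sup_left fun h => hfI
        (h ▸ Ideal.mem_sup_right (Ideal.mem_span_singleton_self _))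
    obtain ⟨P, hP, hPl⟩ := ih _ hlt1 (isHomogeneous_colon hI hf)
    obtain ⟨Q, hQ, hQl⟩ := ih _ hlt2 (isHomogeneous_sup_span hI hf)
    refine ⟨P.comp (Polynomial.X - Polynomial.C (e : ℚ)) + Q, ?_, ?_⟩
    · rw [← Filter.map_add_atTop_eq_nat e, Filter.eventually_map]
      filter_upwards [hP, (Filter.tendsto_add_atTop_nat e).eventually hQ] with m hm hm'
      rw [idealHilbertFunction_eq_colon_add_sup hI hf hf0 m]
      push_cast at hm' ⊢
      simp [hm, hm']
    · have hdegP : (P.comp (Polynomial.X - Polynomial.C (e : ℚ))).natDegree = P.natDegree := by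
        rw [Polynomial.natDegree_comp, Polynomial.natDegree_X_sub_C, mul_one]
      have hadd := Polynomial.natDegree_add_le (P.comp (Polynomial.X - Polynomial.C (e : ℚ))) Q
      rw [hdegP] at hadd
      obtain rfl | ⟨l₁, hl₁, hlen₁⟩ := hPl
      · obtain rfl | ⟨l₂, hl₂, hlen₂⟩ := hQl
        · simp
        · exact .inr ⟨l₂, hl₂.trans (idealZeros_anti hlt2.le), hadd.trans (by simpa using hlen₂)⟩
      · obtain rfl | ⟨l₂, hl₂, hlen₂⟩ := hQl
        · exact .inr ⟨l₁, hl₁.trans (idealZeros_anti hlt1.le), hadd.trans (by simpa using hlen₁)⟩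
        · refine .inr ?_
          -- The summand of larger degree supplies the chain; both zero sets lie in that of `I`.
          rcases le_total P.natDegree Q.natDegree with h | h
          · exact ⟨l₂, hl₂.trans (idealZeros_anti hlt2.le), by omega⟩
          · exact ⟨l₁, hl₁.trans (idealZeros_anti hlt1.le), by omega⟩

theorem isHomogeneous_homogIdeal (X : Set (ProjSpace n)) :
    (homogIdeal X).IsHomogeneous (homogeneousSubmodule (Fin (n + 1)) ℂ) :=
  Ideal.homogeneous_span _ _ fun _ hf => hf.1

theorem idealZeros_homogIdeal_subset {X : Set (ProjSpace n)} (hX : IsClosed X) :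
    idealZeros (homogIdeal X) ⊆ X := by
  obtain ⟨S, hS, rfl⟩ := isClosed_iff_isZariskiClosed.mp hX
  exact fun p hp f hf => hp f ⟨hS f hf, Ideal.subset_span ⟨hS f hf, fun q hq => hq f hf⟩⟩

theorem eventually_eval_hilbertPolynomial (X : Set (ProjSpace n)) :
    ∀ᶠ m : ℕ in Filter.atTop,
      (hilbertPolynomial X).eval (m : ℚ) = (hilbertFunction X m : ℚ) := by
  obtain ⟨P, hP, -⟩ := exists_polynomial_eventually_eq_idealHilbertFunction (homogIdeal X)
    (isHomogeneous_homogIdeal X)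
  have h : ∃ P : Polynomial ℚ, ∀ᶠ m : ℕ in Filter.atTop,
      P.eval (m : ℚ) = (hilbertFunction X m : ℚ) := ⟨P, hP⟩
  rw [hilbertPolynomial, dif_pos h]
  exact h.choose_spec

/-- The degree of the Hilbert polynomial of a projective variety is at most its dimension. -/
theorem natDegree_hilbertPolynomial_le {X : Set (ProjSpace n)} (hX : IsClosed X) {d : ℕ}
    (hd : projDim X = ((d : ℕ∞) : WithBot ℕ∞)) : (hilbertPolynomial X).natDegree ≤ d := by
  obtain ⟨P, hP, hPl⟩ := exists_polynomial_eventually_eq_idealHilbertFunction (homogIdeal X)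
    (isHomogeneous_homogIdeal X)
  have heq : hilbertPolynomial X = P := by
    refine Polynomial.eq_of_infinite_eval_eq _ _ ?_
    obtain ⟨N, hN⟩ := Filter.eventually_atTop.mp ((eventually_eval_hilbertPolynomial X).and hP)
    refine ((Set.Ici_infinite N).image (Nat.cast_injective (R := ℚ)).injOn).mono ?_
    rintro _ ⟨m, hm, rfl⟩
    exact (hN m hm).1.trans (hN m hm).2.symm
  rw [heq]
  obtain rfl | ⟨l, hl, hlen⟩ := hPl
  · simp
  · have := length_le_projDim l (hl.trans (idealZeros_homogIdeal_subset hX))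
    rw [hd] at this
    exact hlen.trans (by exact_mod_cast this)

end ZariskiTopology

/-! ### Distance sets and the polynomial method -/

section DistanceSets

open MvPolynomial

variable {n : ℕ}

theorem totalDegree_sq_sub_dist_le (r : ℂ) :
    (C (r ^ 2) - ∑ i : Fin n, (X (Sum.inl i) - X (Sum.inr i)) ^ 2 :
      MvPolynomial (Fin n ⊕ Fin n) ℂ).totalDegree ≤ 2 := by
  refine (totalDegree_sub _ _).trans (max_le (by rw [totalDegree_C]; exact zero_le) ?_)
  refine totalDegree_finsetSum_le fun i _ => (totalDegree_pow _ _).trans ?_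
  have : (X (Sum.inl i) - X (Sum.inr i) : MvPolynomial (Fin n ⊕ Fin n) ℂ).totalDegree ≤ 1 :=
    (totalDegree_sub _ _).trans (by simp)
  omega

/-- The moments of degree at most `s` separate the complex weights on an `s`-distance set. -/
theorem eq_zero_of_moments_eq_zero {s : ℕ} {A : Finset (EuclideanSpace ℝ (Fin n))}
    (hA : IsDistanceSet s (A : Set (EuclideanSpace ℝ (Fin n)))) {v : A → ℂ}
    (hv : ∀ α : Fin n → ℕ, ∑ i, α i ≤ s →
      ∑ a, v a * ∏ i, ((a : EuclideanSpace ℝ (Fin n)) i : ℂ) ^ α i = 0) :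
    v = 0 := by
  have hfin : (distances (A : Set (EuclideanSpace ℝ (Fin n)))).Finite :=
    Set.finite_of_encard_le_coe hA
  set D := hfin.toFinset
  have hcard : D.card ≤ s := by
    have h : (distances (A : Set (EuclideanSpace ℝ (Fin n)))).encard ≤ s := hA
    rw [hfin.encard_eq_coe_toFinset_card] at h
    exact_mod_cast h
  have hpos : ∀ r ∈ D, r ≠ 0 := by
    intro r hr
    obtain ⟨p, -, q, -, hpq, rfl⟩ := hfin.mem_toFinset.mp hr
    exact dist_ne_zero.mpr hpq
  let f : MvPolynomial (Fin n ⊕ Fin n) ℂ :=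
    ∏ r ∈ D, (C ((r : ℂ) ^ 2) - ∑ i : Fin n, (X (Sum.inl i) - X (Sum.inr i)) ^ 2)
  have hdeg : f.totalDegree ≤ 2 * s := by
    refine (totalDegree_finsetProd _ _).trans ((Finset.sum_le_sum fun (r : ℝ) _ =>
      totalDegree_sq_sub_dist_le (r : ℂ)).trans ?_)
    rw [Finset.sum_const, smul_eq_mul]
    omega
  let pt (a b : A) : Fin n ⊕ Fin n → ℂ :=
    Sum.elim (fun i => ((a : EuclideanSpace ℝ (Fin n)) i : ℂ))
      (fun i => ((b : EuclideanSpace ℝ (Fin n)) i : ℂ))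
  have heval (a b : A) : eval (pt a b) f = ∏ r ∈ D, (((r ^ 2 - dist a b ^ 2 : ℝ)) : ℂ) := by
    have hdist : dist a b ^ 2 = ∑ i, ((a : EuclideanSpace ℝ (Fin n)) i -
        (b : EuclideanSpace ℝ (Fin n)) i) ^ 2 := by
      rw [Subtype.dist_eq, EuclideanSpace.dist_eq, Real.sq_sqrt (by positivity)]
      simp [Real.dist_eq, sq_abs]
    rw [hdist, map_prod]
    refine Finset.prod_congr rfl fun r _ => ?_
    simp [pt]
  have hoff (a b : A) (hab : a ≠ b) : eval (pt a b) f = 0 := by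
    rw [heval]
    refine Finset.prod_eq_zero (i := dist a b) (hfin.mem_toFinset.mpr
      ⟨a, a.2, b, b.2, fun h => hab (Subtype.ext h), rfl⟩) (by simp)
  have hdiag (a : A) : eval (pt a a) f = ∏ r ∈ D, (r : ℂ) ^ 2 := by
    rw [heval]
    simp
  have hne : ∏ r ∈ D, (r : ℂ) ^ 2 ≠ 0 :=
    Finset.prod_ne_zero_iff.mpr fun r hr => pow_ne_zero _ (by exact_mod_cast hpos r hr)
  -- The points are real, so conjugation affects only the weights.
  have hconj (α : Fin n → ℕ) (hα : ∑ i, α i ≤ s) :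
      ∑ a, (starRingEnd ℂ) (v a) * ∏ i, ((a : EuclideanSpace ℝ (Fin n)) i : ℂ) ^ α i = 0 := by
    have := congrArg (starRingEnd ℂ) (hv α hα)
    simpa using this
  have hzero : ∑ a, ∑ b, (starRingEnd ℂ) (v a) * v b * eval (pt a b) f = 0 := by
    have hterm (a b : A) : (starRingEnd ℂ) (v a) * v b * eval (pt a b) f =
        ∑ d ∈ f.support, coeff d f *
          (((starRingEnd ℂ) (v a) * ∏ i, ((a : EuclideanSpace ℝ (Fin n)) i : ℂ) ^ d (Sum.inl i)) *
          (v b * ∏ i, ((b : EuclideanSpace ℝ (Fin n)) i : ℂ) ^ d (Sum.inr i))) := by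
      rw [eval_eq', Finset.mul_sum]
      refine Finset.sum_congr rfl fun d _ => ?_
      rw [Fintype.prod_sum_type]
      simp only [pt, Sum.elim_inl, Sum.elim_inr]
      ring
    simp_rw [hterm]
    rw [Finset.sum_congr rfl fun a _ => Finset.sum_comm, Finset.sum_comm]
    refine Finset.sum_eq_zero fun d hd => ?_
    simp_rw [← Finset.mul_sum, ← Finset.sum_mul]
    have hle : ∑ i, d (Sum.inl i) + ∑ i, d (Sum.inr i) ≤ 2 * s := by
      rw [← Fintype.sum_sum_type (fun i => d i)]
      refine le_trans (le_of_eq ?_) ((le_totalDegree hd).trans hdeg)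
      rw [Finsupp.sum_fintype _ _ (fun _ => rfl)]
    -- The two partial degrees add up to at most `2s`, so one of them is at most `s` and its moment
    -- vanishes.
    rcases le_or_gt (∑ i, d (Sum.inl i)) s with h | h
    · rw [hconj _ h, zero_mul, mul_zero]
    · rw [hv (fun i => d (Sum.inr i)) (by omega), mul_zero, mul_zero]
  have hsum : ∑ a, (starRingEnd ℂ) (v a) * v a = 0 := by
    have h : (∑ a, (starRingEnd ℂ) (v a) * v a) * ∏ r ∈ D, (r : ℂ) ^ 2 = 0 := by
      rw [← hzero, Finset.sum_mul]
      refine Finset.sum_congr rfl fun a _ => ?_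
      rw [Finset.sum_eq_single a (fun b _ hb => by rw [hoff a b hb.symm, mul_zero])
        (fun h => absurd (Finset.mem_univ a) h), hdiag]
    exact (mul_eq_zero.mp h).resolve_right hne
  have hsum' : ∑ a, Complex.normSq (v a) = 0 := by
    simp_rw [← Complex.normSq_eq_conj_mul_self] at hsum
    exact_mod_cast hsum
  funext a
  exact Complex.normSq_eq_zero.mp ((Finset.sum_eq_zero_iff_of_nonneg
    fun b _ => Complex.normSq_nonneg (v b)).mp hsum' a (Finset.mem_univ a))

theorem eval_rep_eq_zero_of_mem_homogIdeal {X : Set (ProjSpace n)}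
    {f : MvPolynomial (Fin (n + 1)) ℂ} (hf : f ∈ homogIdeal X) {p : ProjSpace n} (hp : p ∈ X) :
    eval p.rep f = 0 := by
  have h : homogIdeal X ≤ RingHom.ker (eval p.rep) :=
    Ideal.span_le.mpr fun g hg => hg.2 p hp
  exact h hf

/-- An `s`-distance set on an affine variety has at most as many points as the value at `s` of the
Hilbert function of the projective closure. -/
theorem card_le_hilbertFunction {V : Set (Fin n → ℂ)} {s : ℕ}
    {A : Finset (EuclideanSpace ℝ (Fin n))} (hAV : ∀ x ∈ A, toComplex x ∈ V)
    (hA : IsDistanceSet s (A : Set (EuclideanSpace ℝ (Fin n)))) :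
    A.card ≤ hilbertFunction (projClosure V) s := by
  let pt (a : A) : Fin (n + 1) → ℂ := Fin.cons 1 (toComplex (a : EuclideanSpace ℝ (Fin n)))
  let ev : homogeneousSubmodule (Fin (n + 1)) ℂ s →ₗ[ℂ] (A → ℂ) :=
    LinearMap.pi fun a => (aeval (R := ℂ) (pt a)).toLinearMap ∘ₗ Submodule.subtype _
  have hev (F) (a : A) : ev F a = eval (pt a) (F : MvPolynomial (Fin (n + 1)) ℂ) := by
    simp [ev, aeval_eq_eval]
  have hker : ((homogIdeal (projClosure V)).restrictScalars ℂ).comap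
      (homogeneousSubmodule (Fin (n + 1)) ℂ s).subtype ≤ LinearMap.ker ev := by
    intro F hF
    rw [LinearMap.mem_ker]
    funext a
    rw [hev]
    have hmem : toProj (toComplex (a : EuclideanSpace ℝ (Fin n))) ∈ projClosure V :=
      @subset_closure _ (zariskiTopology n) _ _ ⟨_, hAV a a.2, rfl⟩
    exact (eval_mk_rep_eq_zero_iff ⟨s, F.2⟩ _).mp (eval_rep_eq_zero_of_mem_homogIdeal hF hmem)
  have hsurj : LinearMap.range ev = ⊤ := by
    by_contra hne
    obtain ⟨φ, hφ, hle⟩ := Submodule.exists_le_ker_of_lt_top _ (lt_top_iff_ne_top.mpr hne)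
    have hφsum (u : A → ℂ) : φ u = ∑ a, φ (Pi.single a 1) * u a := by
      conv_lhs => rw [pi_eq_sum_univ' u]
      simp [map_sum, mul_comm]
    refine hφ (LinearMap.ext fun u => ?_)
    have hv : (fun a => φ (Pi.single a 1)) = 0 := by
      refine eq_zero_of_moments_eq_zero hA fun α hα => ?_
      -- Padding with `X 0`, which equals 1 at every `pt a`, realises each monomial of degree at
      -- most `s` by a form of degree exactly `s`.
      have hF : (X 0 ^ (s - ∑ i, α i) * ∏ i : Fin n, X i.succ ^ α i :
          MvPolynomial (Fin (n + 1)) ℂ).IsHomogeneous s := by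
        have h := (isHomogeneous_X_pow (R := ℂ) (0 : Fin (n + 1)) (s - ∑ i, α i)).mul
          (IsHomogeneous.prod Finset.univ (fun i : Fin n => X i.succ ^ α i) α
            fun i _ => isHomogeneous_X_pow i.succ (α i))
        rwa [Nat.sub_add_cancel hα] at h
      have h0 : φ (ev ⟨_, hF⟩) = 0 := hle ⟨_, rfl⟩
      rw [hφsum] at h0
      rw [← h0]
      refine Finset.sum_congr rfl fun a _ => ?_
      rw [hev]
      simp [pt, toComplex]
    rw [hφsum]
    exact Finset.sum_eq_zero fun a _ => by rw [congrFun hv a]; simp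
  have hsurj' : Function.Surjective (Submodule.liftQ _ ev hker) := by
    rw [← LinearMap.range_eq_top, Submodule.range_liftQ, hsurj]
  have h := LinearMap.finrank_le_finrank_of_surjective hsurj'
  rw [Module.finrank_fintype_fun_eq_card, Fintype.card_coe] at h
  exact h

theorem finite_and_ncard_le_hilbertFunction {V : Set (Fin n → ℂ)} {s : ℕ}
    {A : Set (EuclideanSpace ℝ (Fin n))} (hAV : ∀ x ∈ A, toComplex x ∈ V)
    (hA : IsDistanceSet s A) :
    A.Finite ∧ A.ncard ≤ hilbertFunction (projClosure V) s := by
  -- A uniform bound on all finite subsets forces `A` itself to be finite.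
  have key (F : Finset (EuclideanSpace ℝ (Fin n))) (hF : (F : Set _) ⊆ A) :
      F.card ≤ hilbertFunction (projClosure V) s := by
    refine card_le_hilbertFunction (fun x hx => hAV x (hF hx))
      (le_trans (Set.encard_le_encard ?_) hA)
    rintro r ⟨p, hp, q, hq, h⟩
    exact ⟨p, hF hp, q, hF hq, h⟩
  have hfin : A.Finite := by
    by_contra hinf
    obtain ⟨F, hF, hcard⟩ := Set.Infinite.exists_subset_card_eq hinf
      (hilbertFunction (projClosure V) s + 1)
    have := key F hF
    omega
  refine ⟨hfin, ?_⟩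
  rw [Set.ncard_eq_toFinset_card A hfin]
  exact key _ (by simp)

end DistanceSets

/-! ### From the Hilbert polynomial to the explicit bound -/

section Asymptotics

open Polynomial

/-- A function on the positive integers that is eventually polynomial is bounded by the top term up
to an error of lower order. -/
theorem exists_le_top_term_add {P : ℚ[X]} {d : ℕ} (hP : P.natDegree ≤ d) {H : ℕ → ℕ}
    (hH : ∀ᶠ m : ℕ in Filter.atTop, P.eval (m : ℚ) = (H m : ℚ)) {c : ℝ}
    (hc : (P.coeff d : ℝ) ≤ c) :
    ∃ C : ℝ, ∀ s : ℕ, 1 ≤ s → (H s : ℝ) ≤ c * (s : ℝ) ^ d + C * (s : ℝ) ^ ((d : ℤ) - 1) := by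
  obtain ⟨N, hN⟩ := Filter.eventually_atTop.mp hH
  set C₁ : ℝ := ∑ i ∈ Finset.range d, |(P.coeff i : ℝ)|
  -- The weight `m` compensates for the factor `s^(d-1)`, which is below 1 when `d = 0` and `s > 1`:
  -- only `s * s^(d-1) ≥ 1` is available.
  set C₂ : ℝ := ∑ m ∈ Finset.range N, |(H m : ℝ) - c * (m : ℝ) ^ d| * m
  have hC₁ : 0 ≤ C₁ := Finset.sum_nonneg fun _ _ => abs_nonneg _
  have hC₂ : 0 ≤ C₂ := Finset.sum_nonneg fun _ _ => by positivity
  refine ⟨C₁ + C₂, fun s hs => ?_⟩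
  have hs1 : (1 : ℝ) ≤ s := by exact_mod_cast hs
  have hs0 : (0 : ℝ) < s := by linarith
  have hz : (0 : ℝ) < (s : ℝ) ^ ((d : ℤ) - 1) := zpow_pos hs0 _
  rcases lt_or_ge s N with hsN | hsN
  · have h1 : |(H s : ℝ) - c * (s : ℝ) ^ d| * s ≤ C₂ :=
      Finset.single_le_sum (f := fun m : ℕ => |(H m : ℝ) - c * (m : ℝ) ^ d| * m)
        (fun _ _ => by positivity) (Finset.mem_range.mpr hsN)
    have h2 : 1 ≤ (s : ℝ) * (s : ℝ) ^ ((d : ℤ) - 1) := by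
      rw [← zpow_one_add₀ hs0.ne']
      simpa using one_le_pow₀ hs1
    have h3 : |(H s : ℝ) - c * (s : ℝ) ^ d| ≤
        |(H s : ℝ) - c * (s : ℝ) ^ d| * s * (s : ℝ) ^ ((d : ℤ) - 1) := by
      rw [mul_assoc]
      exact le_mul_of_one_le_right (abs_nonneg _) h2
    have h4 := mul_le_mul_of_nonneg_right h1 hz.le
    have h5 := mul_nonneg hC₁ hz.le
    have h6 := le_abs_self ((H s : ℝ) - c * (s : ℝ) ^ d)
    linarith
  · have hev : (H s : ℝ) = ∑ i ∈ Finset.range (d + 1), (P.coeff i : ℝ) * (s : ℝ) ^ i := by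
      have h := hN s hsN
      rw [eval_eq_sum_range' (Nat.lt_succ_of_le hP)] at h
      exact_mod_cast h.symm
    have hlow : ∑ i ∈ Finset.range d, (P.coeff i : ℝ) * (s : ℝ) ^ i ≤
        C₁ * (s : ℝ) ^ ((d : ℤ) - 1) := by
      rw [Finset.sum_mul]
      refine Finset.sum_le_sum fun i hi => ?_
      have hi' := Finset.mem_range.mp hi
      refine mul_le_mul (le_abs_self _) ?_ (by positivity) (abs_nonneg _)
      rw [← zpow_natCast]
      exact zpow_le_zpow_right₀ hs1 (by omega)
    rw [hev, Finset.sum_range_succ]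
    have h1 := mul_le_mul_of_nonneg_right hc (pow_nonneg hs0.le d)
    have h2 := mul_nonneg hC₂ hz.le
    linarith

end Asymptotics

end FewDistances

theorem corollary9 (n : ℕ) (V : Set (Fin n → ℂ)) (hV : FewDistances.IsAffineVariety V)
    (d k : ℕ)
    (hd : FewDistances.projDim (FewDistances.projClosure V) = ((d : ℕ∞) : WithBot ℕ∞))
    (hk : FewDistances.projDegree (FewDistances.projClosure V) = (k : ℚ))
    (hreal : FewDistances.IsGeneratedByReal (MvPolynomial.vanishingIdeal ℂ V)) :
    ∃ C : ℝ, ∀ s : ℕ, 1 ≤ s → ∀ A : Set (EuclideanSpace ℝ (Fin n)),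
      (∀ x ∈ A, FewDistances.toComplex x ∈ V) →
      FewDistances.IsDistanceSet s A →
        A.Finite ∧
        (A.ncard : ℝ) ≤ (k : ℝ) * (s : ℝ) ^ d / (Nat.factorial d : ℝ)
          + C * (s : ℝ) ^ ((d : ℤ) - 1) := by
  have hdeg : (FewDistances.hilbertPolynomial (FewDistances.projClosure V)).natDegree ≤ d :=
    FewDistances.natDegree_hilbertPolynomial_le (@isClosed_closure _ (FewDistances.zariskiTopology n) _) hd
  have hcoeff : ((FewDistances.hilbertPolynomial (FewDistances.projClosure V)).coeff d : ℝ) ≤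
      (k : ℝ) / (Nat.factorial d : ℝ) := by
    -- The bound `natDegree ≤ d` suffices: if it is strict, the coefficient at `d` is zero;
    -- otherwise it is exactly `k / d!`.
    obtain hlt | heq := hdeg.lt_or_eq
    · rw [Polynomial.coeff_eq_zero_of_natDegree_lt hlt, Rat.cast_zero]
      positivity
    · rw [FewDistances.projDegree, Polynomial.leadingCoeff] at hk
      rw [heq] at hk
      rw [le_div_iff₀ (by positivity), mul_comm]
      exact_mod_cast hk.le
  obtain ⟨C, hC⟩ := FewDistances.exists_le_top_term_add hdeg
    (FewDistances.eventually_eval_hilbertPolynomial _) hcoeff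
  refine ⟨C, fun s hs A hAV hA => ?_⟩
  obtain ⟨hfin, hcard⟩ := FewDistances.finite_and_ncard_le_hilbertFunction hAV hA
  refine ⟨hfin, ?_⟩
  rw [mul_div_right_comm]
  exact (Nat.cast_le.mpr hcard).trans (hC s hs)
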